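/- Let $(X,d)$ be a compact metric space with a finite Borel measure $\mu$ that is Ahlfors $d_f$-regular for some $d_f>0$, i.e. there is $C\ge 1$ such that $C^{-1}r^{d_f}\le\mu(\overline B(x,r))\le Cr^{d_f}$ for all $x\in X$ and $0\le r<\operatorname{diam}X$. Let $\mathbb K=\mathbb R$ or $\mathbb C$, let $0<2\alpha<\beta\le 1$, and let $\text{Höl}_\beta(X,d)$ be the space of $\beta$-Hölder continuous functions $h:X\to\mathbb K$, with $\text{Höl}_\beta(h)$ the smallest constant $c\ge 0$ such that $|h(x)-h(y)|\le c\,d(x,y)^\beta$ for all $x,y\in X$. For $h\in\text{Höl}_\beta(X,d)$ let $K_{\alpha,h}$ be the bounded integral operator on $L^2(X,\mu)=L^2(X,\mu;\mathbb K)$ $$K_{\alpha,h}f(x)=\int_X\frac{h(x)-h(y)}{d(x,y)^{d_f+2\alpha}}f(y)\,d\mu(y)$$ (the kernel being $0$ on the diagonal; for every $f\in L^2(X,\mu)$ the integral converges absolutely for $\mu$-almost every $x$, and this defines a unique bounded operator, which is part of the claim). For real $p>0$ let $\mathcal S_p$ be the set of compact operators $T$ on $L^2(X,\mu)$ whose sequence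 $(s_n(T))_n$ of singular values, in decreasing order and counted with multiplicity, lies in $\ell^p$, with $\|T\|_{\mathcal S_p}=\big(\sum_n s_n(T)^p\big)^{1/p}$ (a quasi-norm when $p<1$). Put $\ell=\lceil d_f/\beta\rceil+1$ and $p(\alpha,\beta)=\ell\,d_f/(\beta-2\alpha)$. Then for every $p>p(\alpha,\beta)$ there is a constant $L>0$, not depending on $h$, such that for every $h\in\text{Höl}_\beta(X,d)$ one has $K_{\alpha,h}\in\mathcal S_p$ and $$\|K_{\alpha,h}\|_{\mathcal S_p}\le L\,\text{Höl}_\beta(h).$$ Moreover, if $d_f/(\beta-2\alpha)\ge 2$, the same holds with $\ell=1$, i.e. for every $p>d_f/(\beta-2\alpha)$. -/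

import Mathlib

open MeasureTheory
open scoped NNReal

/-- The measure `μ` on the metric space `X` is Ahlfors `df`-regular: for some `C ≥ 1`,
`C⁻¹ r ^ df ≤ μ (closedBall x r) ≤ C r ^ df` for every `x` and every `0 ≤ r < diam X`. -/
def IsAhlforsRegular {X : Type*} [MetricSpace X] [MeasurableSpace X]
    (μ : Measure X) (df : ℝ) : Prop :=
  ∃ C : ℝ, 1 ≤ C ∧ ∀ x : X, ∀ r : ℝ, 0 ≤ r → r < Metric.diam (Set.univ : Set X) →
    ENNReal.ofReal (C⁻¹ * r ^ df) ≤ μ (Metric.closedBall x r) ∧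
      μ (Metric.closedBall x r) ≤ ENNReal.ofReal (C * r ^ df)

section Schatten

variable {𝕜 H : Type*} [RCLike 𝕜] [NormedAddCommGroup H] [InnerProductSpace 𝕜 H]
  [CompleteSpace H]

/-- The span of the eigenspaces of `T† T` for the eigenvalues `> t ^ 2`. When `T` is compact and
`t ≥ 0`, its dimension is the number of singular values of `T`, counted with multiplicity, that
are `> t`. -/
noncomputable def upperSingularSpace (T : H →L[𝕜] H) (t : ℝ) : Submodule 𝕜 H :=
  ⨆ (a : ℝ) (_ : t ^ 2 < a),
    Module.End.eigenspace
      (((ContinuousLinearMap.adjoint T).comp T : H →L[𝕜] H) : H →ₗ[𝕜] H) (a : 𝕜)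

/-- The singular values of a compact operator `T`, that is, the square roots of the eigenvalues of
`T† T`, in decreasing order and counted with multiplicity, indexed from `0`: the `n`-th one is the
least `t ≥ 0` such that at most `n` singular values (with multiplicity) are `> t`. -/
noncomputable def singularValue (T : H →L[𝕜] H) (n : ℕ) : ℝ :=
  sInf {t : ℝ | 0 ≤ t ∧ Module.rank 𝕜 (upperSingularSpace T t) ≤ n}

/-- `T` belongs to the Schatten ideal `S_p(H)`. -/
def MemSchatten (p : ℝ) (T : H →L[𝕜] H) : Prop :=
  IsCompactOperator T ∧ Summable fun n : ℕ => singularValue T n ^ p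

/-- The Schatten (quasi-)norm, meant for `0 < p` and `T` in `S_p(H)`. -/
noncomputable def schattenNorm (p : ℝ) (T : H →L[𝕜] H) : ℝ :=
  (∑' n : ℕ, singularValue T n ^ p) ^ (1 / p)

end Schatten

/-- The kernel `(h x - h y) / d(x, y) ^ (df + 2α)`; its value on the diagonal is `0`. -/
noncomputable def commutatorKernel {X 𝕜 : Type*} [MetricSpace X] [RCLike 𝕜]
    (df α : ℝ) (h : X → 𝕜) (x y : X) : 𝕜 :=
  (h x - h y) / ((dist x y ^ (df + 2 * α) : ℝ) : 𝕜)

/-- The bounded operator `T` on `L²(X, μ)` is the integral operator with kernel `k`: for every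
`f ∈ L²` and almost every `x` the integral `∫ k(x, y) f(y) dμ(y)` converges absolutely and
equals `T f (x)`. -/
def IsIntegralOperator {X 𝕜 : Type*} [MeasurableSpace X] [RCLike 𝕜] (μ : Measure X)
    (k : X → X → 𝕜) (T : Lp 𝕜 2 μ →L[𝕜] Lp 𝕜 2 μ) : Prop :=
  ∀ f : Lp 𝕜 2 μ, ∀ᵐ x ∂μ,
    Integrable (fun y => k x y * f y) μ ∧ T f x = ∫ y, k x y * f y ∂μ

/-! The kernel is smooth enough in `y` to be replaced by finitely many frozen values. Cut `X` into
`N = O(ε ^ (-df))` cells of radius `ε`, freeze `y` at the centre of its cell, and drop the kernel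
near the diagonal. The frozen kernel annihilates every `f` with zero mean on all cells, so on such
`f` the operator acts through the error kernel alone, which is `O(Höl(h) min(d, ε) ^ β / d ^ (df +
2α))` (`norm_commutatorKernel_sub_ite_le`). Ahlfors regularity and the Schur test bound its norm by
`O(Höl(h) ε ^ (β - 2α))` (`exists_orthogonal_norm_le`).

Thus `N` orthogonality conditions bring the norm of `T` down to this size. Taking `N` of order `n`
gives `s_n(T) = O(Höl(h) n ^ (-(β - 2α) / df))`, which is `p`-summable for every `p > df / (β -
2α)`. Both thresholds of the theorem are at least this one. -/

open scoped ENNReal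

/-! ### Singular values and compactness from finitely many orthogonality conditions. -/

section Hilbert

variable {𝕜 H : Type*} [RCLike 𝕜] [NormedAddCommGroup H] [InnerProductSpace 𝕜 H]
  [CompleteSpace H]

/-- Eigenspaces of `T† T` are mutually orthogonal, so for `f = ∑ v_i` with eigenvalues `a_i > t ^ 2`
one has `‖T f‖ ^ 2 = ∑ a_i ‖v_i‖ ^ 2`. -/
theorem mul_norm_lt_of_mem_upperSingularSpace (T : H →L[𝕜] H) {t : ℝ} {f : H}
    (hf : f ∈ upperSingularSpace T t) (hf0 : f ≠ 0) : t * ‖f‖ < ‖T f‖ := by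
  classical
  set S : H →L[𝕜] H := (ContinuousLinearMap.adjoint T).comp T with hS
  have hsymm : (S : H →ₗ[𝕜] H).IsSymmetric := by
    intro x y
    simp [hS, ContinuousLinearMap.adjoint_inner_left, ContinuousLinearMap.adjoint_inner_right]
  have hV := hsymm.orthogonalFamily_eigenspaces.comp
    (γ := {a : ℝ // t ^ 2 < a}) (f := fun a => ((a : ℝ) : 𝕜))
    (fun a b hab => Subtype.ext (RCLike.ofReal_injective hab))
  rw [upperSingularSpace, iSup_subtype', Submodule.mem_iSup_iff_exists_dfinsupp] at hf
  obtain ⟨v, rfl⟩ := hf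
  rw [DFinsupp.lsum_apply_apply, DFinsupp.sumAddHom_apply] at hf0 ⊢
  simp only [DFinsupp.sum, LinearMap.toAddMonoidHom_coe, Submodule.subtype_apply] at hf0 ⊢
  have hnorm : ‖∑ i ∈ v.support, (v i : H)‖ ^ 2 = ∑ i ∈ v.support, ‖v i‖ ^ 2 :=
    hV.norm_sum (fun i => v i) v.support
  have hSv : ∀ i, S (v i : H) = ((i : ℝ) : 𝕜) • (v i : H) := fun i =>
    Module.End.mem_eigenspace_iff.1 (v i).2
  have hT : ‖T (∑ i ∈ v.support, (v i : H))‖ ^ 2 = ∑ i ∈ v.support, (i : ℝ) * ‖v i‖ ^ 2 := by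
    have h1 : ((‖T (∑ i ∈ v.support, (v i : H))‖ : ℝ) : 𝕜) ^ 2
        = ∑ i ∈ v.support, ((i : ℝ) : 𝕜) * ((‖v i‖ : ℝ) : 𝕜) ^ 2 := by
      rw [← inner_self_eq_norm_sq_to_K, ← ContinuousLinearMap.adjoint_inner_right]
      change inner 𝕜 _ (S _) = _
      have hsum : S (∑ i ∈ v.support, (v i : H))
          = ∑ i ∈ v.support, ((((i : ℝ) : 𝕜) • v i : _) : H) := by
        rw [map_sum]
        exact Finset.sum_congr rfl fun i _ => hSv i
      rw [hsum]
      refine (hV.inner_sum (fun i => v i) (fun i => ((i : ℝ) : 𝕜) • v i) v.support).trans ?_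
      refine Finset.sum_congr rfl fun i _ => ?_
      rw [inner_smul_right, inner_self_eq_norm_sq_to_K]
    exact_mod_cast h1
  refine lt_of_pow_lt_pow_left₀ 2 (norm_nonneg _) ?_
  rw [mul_pow, hT, hnorm, Finset.mul_sum]
  refine Finset.sum_lt_sum_of_nonempty ?_ fun i hi => ?_
  · by_contra h
    rw [Finset.not_nonempty_iff_eq_empty] at h
    exact hf0 (by rw [h, Finset.sum_empty])
  · have : 0 < ‖v i‖ := norm_pos_iff.2 ((DFinsupp.mem_support_toFun v i).1 hi)
    have := i.2
    gcongr

/-- A nonzero vector of the space orthogonal to all `g i` would contradict the strict lower bound on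
`‖T f‖`; hence pairing with the `g i` embeds the space in `ι → 𝕜`. -/
theorem rank_upperSingularSpace_le (T : H →L[𝕜] H) {t : ℝ} {ι : Type} [Fintype ι]
    (g : ι → H) (hg : ∀ f, (∀ i, inner 𝕜 (g i) f = 0) → ‖T f‖ ≤ t * ‖f‖) :
    Module.rank 𝕜 (upperSingularSpace T t) ≤ (Fintype.card ι : ℕ) := by
  let φ : upperSingularSpace T t →ₗ[𝕜] (ι → 𝕜) :=
    (LinearMap.pi fun i => (innerSL 𝕜 (g i) : H →ₗ[𝕜] 𝕜)) ∘ₗ (upperSingularSpace T t).subtype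
  have hφ : Function.Injective φ := by
    rw [← LinearMap.ker_eq_bot, LinearMap.ker_eq_bot']
    intro f hf
    by_contra hne
    refine (hg f fun i => ?_).not_gt
      (mul_norm_lt_of_mem_upperSingularSpace T f.2 (by simpa using hne))
    exact congrFun hf i
  have := LinearMap.lift_rank_le_of_injective φ hφ
  rw [rank_fun', Cardinal.lift_natCast] at this
  exact_mod_cast Cardinal.lift_le_nat_iff.1 this

theorem singularValue_nonneg (T : H →L[𝕜] H) (n : ℕ) : 0 ≤ singularValue T n :=
  Real.sInf_nonneg fun _ h => h.1

theorem singularValue_le_of_orthogonal (T : H →L[𝕜] H) {t : ℝ} (ht : 0 ≤ t) {N n : ℕ} (hN : N ≤ n)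
    (g : Fin N → H) (hg : ∀ f, (∀ i, inner 𝕜 (g i) f = 0) → ‖T f‖ ≤ t * ‖f‖) :
    singularValue T n ≤ t := by
  refine csInf_le ⟨0, fun _ h => h.1⟩ ⟨ht, ?_⟩
  refine (rank_upperSingularSpace_le T g hg).trans ?_
  simpa using hN

/-- Composing `T` with the projection onto the span of the `g i` gives a finite-rank operator close
to `T`, and compact operators are norm-closed. -/
theorem isCompactOperator_of_orthogonal (T : H →L[𝕜] H)
    (hT : ∀ η : ℝ, 0 < η → ∃ (N : ℕ) (g : Fin N → H),
      ∀ f, (∀ i, inner 𝕜 (g i) f = 0) → ‖T f‖ ≤ η * ‖f‖) :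
    IsCompactOperator T := by
  have hmem : T ∈ closure {S : H →L[𝕜] H | IsCompactOperator S} := by
    rw [Metric.mem_closure_iff]
    intro η hη
    obtain ⟨N, g, hg⟩ := hT (η / 2) (half_pos hη)
    let V : Submodule 𝕜 H := Submodule.span 𝕜 (Set.range g)
    have : FiniteDimensional 𝕜 V := FiniteDimensional.span_of_finite 𝕜 (Set.finite_range g)
    refine ⟨T ∘L V.starProjection, ?_, ?_⟩
    · have : LocallyCompactSpace V := by
        have := FiniteDimensional.proper_rclike 𝕜 V
        infer_instance
      exact (isCompactOperator_of_locallyCompactSpace_rng (T ∘L V.subtypeL)).comp_clm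
        V.orthogonalProjectionOnto
    · rw [dist_eq_norm]
      refine (ContinuousLinearMap.opNorm_le_bound _ (half_pos hη).le fun f => ?_).trans_lt
        (half_lt_self hη)
      have h1 : (T - T ∘L V.starProjection) f = T (f - V.starProjection f) := by simp
      rw [h1]
      refine (hg _ fun i => ?_).trans ?_
      · exact V.inner_right_of_mem_orthogonal (Submodule.subset_span ⟨i, rfl⟩)
          (V.sub_starProjection_mem_orthogonal f)
      · have h2 := V.norm_sq_eq_add_norm_sq_starProjection f
        have h3 : f - V.starProjection f = Vᗮ.starProjection f := by
          rw [Submodule.starProjection_orthogonal']; simp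
        gcongr
        rw [h3]
        exact Submodule.norm_starProjection_apply_le _ f
  rwa [(isClosed_setOfPred_isCompactOperator).closure_eq] at hmem

end Hilbert

/-! ### The Schur test on `L²`. -/

section Schur

theorem ENNReal.sq_lintegral_mul_le {X : Type*} [MeasurableSpace X] (μ : Measure X)
    {k g : X → ℝ≥0∞} (hk : Measurable k) (hg : AEMeasurable g μ) :
    (∫⁻ y, k y * g y ∂μ) ^ 2 ≤ (∫⁻ y, k y ∂μ) * ∫⁻ y, k y * g y ^ 2 ∂μ := by
  have hsplit : ∀ y, k y * g y = (k y ^ (1 / 2 : ℝ)) * (k y ^ (1 / 2 : ℝ) * g y) := fun y => by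
    rw [← mul_assoc, ← ENNReal.rpow_add_of_nonneg _ _ (by norm_num) (by norm_num)]
    norm_num
  have h := ENNReal.lintegral_mul_le_Lp_mul_Lq μ Real.HolderConjugate.two_two
    (f := fun y => k y ^ (1 / 2 : ℝ)) (g := fun y => k y ^ (1 / 2 : ℝ) * g y)
    (hk.pow_const _).aemeasurable ((hk.pow_const _).aemeasurable.mul hg)
  have h1 : ∀ y, (k y ^ (1 / 2 : ℝ)) ^ (2 : ℝ) = k y := fun y => by
    rw [← ENNReal.rpow_mul]; norm_num
  have h2 : ∀ y, (k y ^ (1 / 2 : ℝ) * g y) ^ (2 : ℝ) = k y * g y ^ 2 := fun y => by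
    rw [ENNReal.mul_rpow_of_nonneg _ _ (by norm_num), h1, ENNReal.rpow_two]
  simp only [Pi.mul_apply, ← hsplit, h1, h2] at h
  calc (∫⁻ y, k y * g y ∂μ) ^ 2
      ≤ ((∫⁻ y, k y ∂μ) ^ (1 / 2 : ℝ) * (∫⁻ y, k y * g y ^ 2 ∂μ) ^ (1 / 2 : ℝ)) ^ 2 := by gcongr
    _ = _ := by
      rw [mul_pow, ← ENNReal.rpow_two, ← ENNReal.rpow_two, ← ENNReal.rpow_mul,
        ← ENNReal.rpow_mul]
      norm_num

/-- Cauchy–Schwarz for the measure `Φ x y dμ(y)` uses the row bound; after Tonelli the column bound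
finishes. -/
theorem ENNReal.lintegral_sq_lintegral_mul_le {X : Type*} [MeasurableSpace X] (μ : Measure X)
    [SFinite μ] {Φ : X → X → ℝ≥0∞} (hΦ : Measurable (Function.uncurry Φ)) {A : ℝ≥0∞}
    (h1 : ∀ x, ∫⁻ y, Φ x y ∂μ ≤ A) (h2 : ∀ y, ∫⁻ x, Φ x y ∂μ ≤ A)
    {g : X → ℝ≥0∞} (hg : Measurable g) :
    ∫⁻ x, (∫⁻ y, Φ x y * g y ∂μ) ^ 2 ∂μ ≤ A ^ 2 * ∫⁻ y, g y ^ 2 ∂μ := by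
  calc ∫⁻ x, (∫⁻ y, Φ x y * g y ∂μ) ^ 2 ∂μ
      ≤ ∫⁻ x, A * ∫⁻ y, Φ x y * g y ^ 2 ∂μ ∂μ := by
        refine lintegral_mono fun x => ?_
        exact (ENNReal.sq_lintegral_mul_le μ (hΦ.comp measurable_prodMk_left) hg.aemeasurable).trans
          (mul_le_mul_left (h1 x) _)
    _ = A * ∫⁻ x, ∫⁻ y, Φ x y * g y ^ 2 ∂μ ∂μ := by
        rw [lintegral_const_mul]
        exact Measurable.lintegral_prod_right' (f := fun z : X × X => Φ z.1 z.2 * g z.2 ^ 2)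
          (hΦ.mul ((hg.comp measurable_snd).pow_const 2))
    _ = A * ∫⁻ y, ∫⁻ x, Φ x y * g y ^ 2 ∂μ ∂μ := by
        rw [lintegral_lintegral_swap]
        exact (hΦ.mul ((hg.comp measurable_snd).pow_const 2)).aemeasurable
    _ ≤ A * ∫⁻ y, A * g y ^ 2 ∂μ := by
        refine mul_le_mul_right (lintegral_mono fun y => ?_) _
        have hy : Measurable fun x => Φ x y := hΦ.comp measurable_prodMk_right
        rw [lintegral_mul_const _ hy]
        exact mul_le_mul_left (h2 y) _
    _ = A ^ 2 * ∫⁻ y, g y ^ 2 ∂μ := by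
        rw [lintegral_const_mul _ (hg.pow_const 2), sq, mul_assoc]

variable {X 𝕜 : Type*} [MeasurableSpace X] [RCLike 𝕜] {μ : Measure X}

/-- Only a domination of `F` is assumed, not a kernel for it: later `F = T f`, while `Φ` majorizes
the kernel minus its frozen version. -/
theorem eLpNorm_two_le_of_enorm_le_lintegral [SFinite μ] {Φ : X → X → ℝ≥0∞}
    (hΦ : Measurable (Function.uncurry Φ)) {A : ℝ≥0∞}
    (h1 : ∀ x, ∫⁻ y, Φ x y ∂μ ≤ A) (h2 : ∀ y, ∫⁻ x, Φ x y ∂μ ≤ A) {f F : X → 𝕜}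
    (hf : AEStronglyMeasurable f μ) (hF : ∀ᵐ x ∂μ, ‖F x‖ₑ ≤ ∫⁻ y, Φ x y * ‖f y‖ₑ ∂μ) :
    eLpNorm F 2 μ ≤ A * eLpNorm f 2 μ := by
  obtain ⟨g, hg, hfg⟩ := hf
  rw [eLpNorm_congr_ae hfg]
  have hF' : ∀ᵐ x ∂μ, ‖F x‖ₑ ≤ ∫⁻ y, Φ x y * ‖g y‖ₑ ∂μ := by
    filter_upwards [hF] with x hx
    refine hx.trans_eq (lintegral_congr_ae ?_)
    filter_upwards [hfg] with y hy
    rw [hy]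
  have key : ∫⁻ x, ‖F x‖ₑ ^ 2 ∂μ ≤ A ^ 2 * ∫⁻ y, ‖g y‖ₑ ^ 2 ∂μ :=
    (lintegral_mono_ae (hF'.mono fun x hx => by gcongr)).trans
      (ENNReal.lintegral_sq_lintegral_mul_le μ hΦ h1 h2 hg.measurable.enorm)
  rw [eLpNorm_eq_lintegral_rpow_enorm_toReal (by norm_num) (by norm_num),
    eLpNorm_eq_lintegral_rpow_enorm_toReal (by norm_num) (by norm_num)]
  simp only [ENNReal.toReal_ofNat, ENNReal.rpow_two]
  calc (∫⁻ x, ‖F x‖ₑ ^ 2 ∂μ) ^ (1 / 2 : ℝ) ≤ (A ^ 2 * ∫⁻ y, ‖g y‖ₑ ^ 2 ∂μ) ^ (1 / 2 : ℝ) := by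
        gcongr
    _ = _ := by
      rw [ENNReal.mul_rpow_of_nonneg _ _ (by norm_num), ← ENNReal.rpow_two, ← ENNReal.rpow_mul]
      norm_num

theorem norm_le_of_enorm_le_lintegral [SFinite μ] {Φ : X → X → ℝ≥0∞}
    (hΦ : Measurable (Function.uncurry Φ)) {A : ℝ} (hA : 0 ≤ A)
    (h1 : ∀ x, ∫⁻ y, Φ x y ∂μ ≤ ENNReal.ofReal A) (h2 : ∀ y, ∫⁻ x, Φ x y ∂μ ≤ ENNReal.ofReal A)
    {f F : Lp 𝕜 2 μ} (hF : ∀ᵐ x ∂μ, ‖F x‖ₑ ≤ ∫⁻ y, Φ x y * ‖f y‖ₑ ∂μ) :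
    ‖F‖ ≤ A * ‖f‖ := by
  have h := eLpNorm_two_le_of_enorm_le_lintegral hΦ h1 h2 (Lp.aestronglyMeasurable f) hF
  rw [Lp.norm_def, Lp.norm_def]
  refine (ENNReal.toReal_mono (ENNReal.mul_ne_top ENNReal.ofReal_ne_top (Lp.eLpNorm_ne_top f))
    h).trans_eq ?_
  rw [ENNReal.toReal_mul, ENNReal.toReal_ofReal hA]

/-- The Schur test: a kernel with a suitable majorant defines a bounded operator on `L²`. -/
theorem exists_isIntegralOperator [SFinite μ] {Φ : X → X → ℝ≥0∞}
    (hΦ : Measurable (Function.uncurry Φ)) {A : ℝ} (hA : 0 ≤ A)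
    (h1 : ∀ x, ∫⁻ y, Φ x y ∂μ ≤ ENNReal.ofReal A) (h2 : ∀ y, ∫⁻ x, Φ x y ∂μ ≤ ENNReal.ofReal A)
    {k : X → X → 𝕜} (hk : Measurable (Function.uncurry k)) (hkΦ : ∀ x y, ‖k x y‖ₑ ≤ Φ x y) :
    ∃ T : Lp 𝕜 2 μ →L[𝕜] Lp 𝕜 2 μ, IsIntegralOperator μ k T := by
  have hint : ∀ f : Lp 𝕜 2 μ, ∀ᵐ x ∂μ, Integrable (fun y => k x y * f y) μ := by
    intro f
    have hfin : ∫⁻ x, (∫⁻ y, Φ x y * ‖f y‖ₑ ∂μ) ^ 2 ∂μ < ∞ := by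
      refine (ENNReal.lintegral_sq_lintegral_mul_le μ hΦ h1 h2
        (Lp.stronglyMeasurable f).measurable.enorm).trans_lt ?_
      refine ENNReal.mul_lt_top (by simp) ?_
      have := (lintegral_rpow_enorm_lt_top_of_eLpNorm_lt_top (by norm_num) (by norm_num)
        (Lp.eLpNorm_lt_top f))
      simpa using this
    have hmeas : Measurable fun x => ∫⁻ y, Φ x y * ‖f y‖ₑ ∂μ :=
      Measurable.lintegral_prod_right' (f := fun z : X × X => Φ z.1 z.2 * ‖f z.2‖ₑ)
        (hΦ.mul ((Lp.stronglyMeasurable f).measurable.enorm.comp measurable_snd))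
    filter_upwards [ae_lt_top (hmeas.pow_const 2) hfin.ne] with x hx
    refine ⟨((hk.comp measurable_prodMk_left).mul
      (Lp.stronglyMeasurable f).measurable).aestronglyMeasurable, ?_⟩
    rw [hasFiniteIntegral_iff_enorm]
    refine (lintegral_mono fun y => ?_).trans_lt ((ENNReal.pow_lt_top_iff.1 hx).resolve_right two_ne_zero)
    rw [enorm_mul]
    exact mul_le_mul_left (hkΦ x y) _
  have hbound : ∀ (f : Lp 𝕜 2 μ) x, ‖∫ y, k x y * f y ∂μ‖ₑ ≤ ∫⁻ y, Φ x y * ‖f y‖ₑ ∂μ := by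
    intro f x
    refine (enorm_integral_le_lintegral_enorm _).trans (lintegral_mono fun y => ?_)
    rw [enorm_mul]
    exact mul_le_mul_left (hkΦ x y) _
  have hmem : ∀ f : Lp 𝕜 2 μ, MemLp (fun x => ∫ y, k x y * f y ∂μ) 2 μ := by
    intro f
    refine ⟨?_, ?_⟩
    · exact (StronglyMeasurable.integral_prod_right'
        (f := fun z : X × X => k z.1 z.2 * f z.2) (hk.mul ((Lp.stronglyMeasurable f).measurable.comp
          measurable_snd)).stronglyMeasurable).aestronglyMeasurable
    · exact (eLpNorm_two_le_of_enorm_le_lintegral hΦ h1 h2 (Lp.aestronglyMeasurable f)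
        (Filter.Eventually.of_forall (hbound f))).trans_lt
        (ENNReal.mul_lt_top ENNReal.ofReal_lt_top (Lp.eLpNorm_lt_top f))
  let L : Lp 𝕜 2 μ →ₗ[𝕜] Lp 𝕜 2 μ :=
    { toFun := fun f => (hmem f).toLp _
      map_add' := by
        intro f g
        rw [← MemLp.toLp_add, MemLp.toLp_eq_toLp_iff]
        filter_upwards [hint f, hint g] with x hf hg
        rw [Pi.add_apply, ← integral_add hf hg]
        refine integral_congr_ae ?_
        filter_upwards [Lp.coeFn_add f g] with y hy
        rw [hy, Pi.add_apply, mul_add]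
      map_smul' := by
        intro c f
        rw [RingHom.id_apply, ← MemLp.toLp_const_smul, MemLp.toLp_eq_toLp_iff]
        refine Filter.Eventually.of_forall fun x => ?_
        simp only [Pi.smul_apply]
        rw [← integral_smul]
        refine integral_congr_ae ?_
        filter_upwards [Lp.coeFn_smul c f] with y hy
        rw [hy, Pi.smul_apply, smul_eq_mul, smul_eq_mul]
        ring }
  refine ⟨L.mkContinuous A fun f => norm_le_of_enorm_le_lintegral hΦ hA h1 h2 ?_, fun f => ?_⟩
  · filter_upwards [(hmem f).coeFn_toLp] with x hx
    exact (congrArg _ hx).trans_le (hbound f x)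
  · filter_upwards [(hmem f).coeFn_toLp, hint f] with x hx hi
    exact ⟨hi, hx⟩

theorem IsIntegralOperator.unique {k : X → X → 𝕜} {S T : Lp 𝕜 2 μ →L[𝕜] Lp 𝕜 2 μ}
    (hS : IsIntegralOperator μ k S) (hT : IsIntegralOperator μ k T) : S = T := by
  ext1 f
  refine Lp.ext ?_
  filter_upwards [hS f, hT f] with x h1 h2
  rw [h1.2, h2.2]

end Schur

/-! ### Consequences of Ahlfors regularity: singular integrals and partitions. -/

section Geometry

variable {X : Type*} [MetricSpace X] [MeasurableSpace X] {μ : Measure X} [IsFiniteMeasure μ] {df : ℝ}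

/-- Regularity speaks only of radii below the diameter; for larger ones the total mass is absorbed
into the constant, the diameter being positive. -/
theorem IsAhlforsRegular.exists_measure_closedBall_le [CompactSpace X] [Nontrivial X]
    (hμ : IsAhlforsRegular μ df) (hdf : 0 < df) :
    ∃ C : ℝ, 0 ≤ C ∧ ∀ x : X, ∀ r : ℝ, 0 < r →
      μ (Metric.closedBall x r) ≤ ENNReal.ofReal (C * r ^ df) := by
  obtain ⟨C, hC, h⟩ := hμ
  have hd : 0 < Metric.diam (Set.univ : Set X) :=
    Metric.diam_pos Set.nontrivial_univ isCompact_univ.isBounded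
  set d := Metric.diam (Set.univ : Set X)
  refine ⟨max C (μ.real Set.univ / d ^ df), le_max_of_le_left (by linarith), fun x r hr => ?_⟩
  rcases lt_or_ge r d with hrd | hrd
  · refine (h x r hr.le hrd).2.trans (ENNReal.ofReal_le_ofReal ?_)
    gcongr
    exact le_max_left _ _
  · calc μ (Metric.closedBall x r) ≤ μ Set.univ := measure_mono (Set.subset_univ _)
      _ = ENNReal.ofReal (μ.real Set.univ) := by simp
      _ ≤ _ := by
        refine ENNReal.ofReal_le_ofReal ?_
        calc μ.real Set.univ = μ.real Set.univ / d ^ df * d ^ df := by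
              field_simp
          _ ≤ μ.real Set.univ / d ^ df * r ^ df := by gcongr
          _ ≤ _ := by gcongr; exact le_max_right _ _

/-- These are the contributions of the dyadic annuli in the next estimate, at unit scale. Large
annuli decay with ratio `2 ^ (-a)`, small ones with ratio `2 ^ (a - β)`. -/
theorem summable_min_two_zpow {a β : ℝ} (ha : 0 < a) (hab : a < β) :
    Summable fun k : ℤ => min ((2 : ℝ) ^ (k + 1)) 1 ^ β * ((2 : ℝ) ^ k) ^ (-a) := by
  have hpos : ∀ k : ℤ, 0 ≤ min ((2 : ℝ) ^ (k + 1)) 1 ^ β * ((2 : ℝ) ^ k) ^ (-a) := fun k => by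
    positivity
  refine Summable.of_nat_of_neg ?_ ?_
  · refine Summable.of_nonneg_of_le (fun n => hpos n) (fun n => ?_)
      (summable_geometric_of_lt_one (r := (2 : ℝ) ^ (-a)) (by positivity)
        (Real.rpow_lt_one_of_one_lt_of_neg one_lt_two (by linarith)))
    calc min ((2 : ℝ) ^ ((n : ℤ) + 1)) 1 ^ β * ((2 : ℝ) ^ (n : ℤ)) ^ (-a)
        ≤ 1 * ((2 : ℝ) ^ (n : ℤ)) ^ (-a) := by
          gcongr
          exact Real.rpow_le_one (by positivity) (min_le_right _ _) (by linarith)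
      _ = ((2 : ℝ) ^ (-a)) ^ n := by
          rw [one_mul, zpow_natCast, ← Real.rpow_natCast, ← Real.rpow_natCast,
            ← Real.rpow_mul (by norm_num), ← Real.rpow_mul (by norm_num), mul_comm]
  · refine Summable.of_nonneg_of_le (fun n => hpos _) (fun n => ?_)
      ((summable_geometric_of_lt_one (r := (2 : ℝ) ^ (a - β)) (by positivity)
        (Real.rpow_lt_one_of_one_lt_of_neg one_lt_two (by linarith))).mul_left (2 ^ β))
    calc min ((2 : ℝ) ^ (-(n : ℤ) + 1)) 1 ^ β * ((2 : ℝ) ^ (-(n : ℤ))) ^ (-a)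
        ≤ ((2 : ℝ) ^ (-(n : ℤ) + 1)) ^ β * ((2 : ℝ) ^ (-(n : ℤ))) ^ (-a) := by
          refine mul_le_mul_of_nonneg_right ?_ (by positivity)
          exact Real.rpow_le_rpow (by positivity) (min_le_left _ _) (by linarith)
      _ = 2 ^ β * ((2 : ℝ) ^ (a - β)) ^ n := by
          rw [← Real.rpow_intCast, ← Real.rpow_intCast, ← Real.rpow_natCast,
            ← Real.rpow_mul (by norm_num), ← Real.rpow_mul (by norm_num),
            ← Real.rpow_mul (by norm_num), ← Real.rpow_add (by norm_num),
            ← Real.rpow_add (by norm_num)]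
          congr 1
          push_cast
          ring

/-- The integral of `min (dist x y) ε ^ β / dist x y ^ (df + a)` is at most of order
`ε ^ (β - a)`. -/
theorem IsAhlforsRegular.exists_lintegral_le [CompactSpace X] [BorelSpace X]
    (hμ : IsAhlforsRegular μ df) (hdf : 0 < df)
    {a β : ℝ} (ha : 0 < a) (hab : a < β) :
    ∃ A : ℝ, 0 ≤ A ∧ ∀ ε : ℝ, 0 < ε → ∀ x : X,
      ∫⁻ y, ENNReal.ofReal (min (dist x y) ε ^ β / dist x y ^ (df + a)) ∂μ
        ≤ ENNReal.ofReal (A * ε ^ (β - a)) := by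
  have hβ : 0 < β := ha.trans hab
  rcases subsingleton_or_nontrivial X with hX | hX
  -- With at most one point the diameter is `0` and regularity is void, but the integrand vanishes
  -- since `0 ^ β = 0`.
  · refine ⟨0, le_rfl, fun ε hε x => ?_⟩
    have : ∀ y, ENNReal.ofReal (min (dist x y) ε ^ β / dist x y ^ (df + a)) = 0 := fun y => by
      rw [Subsingleton.elim y x, dist_self, min_eq_left hε.le, Real.zero_rpow hβ.ne']
      simp
    simp [this]
  obtain ⟨C, hC, hball⟩ := hμ.exists_measure_closedBall_le hdf
  have hsum := summable_min_two_zpow ha hab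
  set b : ℤ → ℝ := fun k => min ((2 : ℝ) ^ (k + 1)) 1 ^ β * ((2 : ℝ) ^ k) ^ (-a) with hb
  have hb0 : ∀ k, 0 ≤ b k := fun k => by positivity
  refine ⟨C * 2 ^ df * ∑' k, b k, mul_nonneg (by positivity) (tsum_nonneg hb0), fun ε hε x => ?_⟩
  -- `c k` bounds the integrand on the annulus `2 ^ k ε < dist x y ≤ 2 ^ (k + 1) ε`; enlarging the
  -- annulus to a ball only increases the sum.
  set c : ℤ → ℝ := fun k => min ((2 : ℝ) ^ (k + 1) * ε) ε ^ β / ((2 : ℝ) ^ k * ε) ^ (df + a)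
    with hc
  have hc0 : ∀ k, 0 ≤ c k := fun k => by positivity
  have hpt : ∀ y, ENNReal.ofReal (min (dist x y) ε ^ β / dist x y ^ (df + a)) ≤
      ∑' k : ℤ, (Metric.closedBall x ((2 : ℝ) ^ (k + 1) * ε)).indicator
        (fun _ => ENNReal.ofReal (c k)) y := by
    intro y
    rcases (dist_nonneg (x := x) (y := y)).eq_or_lt with h0 | h0
    · rw [← h0, min_eq_left hε.le, Real.zero_rpow hβ.ne']
      simp
    · obtain ⟨k, hk1, hk2⟩ := exists_mem_Ioc_zpow (div_pos h0 hε) one_lt_two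
      rw [lt_div_iff₀ hε] at hk1
      rw [div_le_iff₀ hε] at hk2
      refine le_trans ?_ (ENNReal.le_tsum k)
      rw [Set.indicator_of_mem (by rwa [Metric.mem_closedBall, dist_comm])]
      refine ENNReal.ofReal_le_ofReal ?_
      simp only [hc]
      gcongr
  have hterm : ∀ k, ENNReal.ofReal (c k) * μ (Metric.closedBall x ((2 : ℝ) ^ (k + 1) * ε)) ≤
      ENNReal.ofReal (C * 2 ^ df * ε ^ (β - a) * b k) := by
    intro k
    refine (mul_le_mul_right (hball x _ (by positivity)) _).trans_eq ?_
    rw [← ENNReal.ofReal_mul (hc0 k)]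
    congr 1
    have h2 : (0 : ℝ) < 2 ^ k := by positivity
    have hmin : min ((2 : ℝ) ^ (k + 1) * ε) ε = min ((2 : ℝ) ^ (k + 1)) 1 * ε := by
      rw [min_mul_of_nonneg _ _ hε.le, one_mul]
    simp only [hc, hb]
    rw [hmin, Real.mul_rpow (by positivity) hε.le, Real.mul_rpow h2.le hε.le,
      Real.mul_rpow (by positivity) hε.le, zpow_add₀ two_ne_zero, zpow_one,
      Real.mul_rpow h2.le zero_le_two, Real.rpow_add h2, Real.rpow_add hε, Real.rpow_neg h2.le,
      Real.rpow_sub hε]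
    field_simp
  calc ∫⁻ y, ENNReal.ofReal (min (dist x y) ε ^ β / dist x y ^ (df + a)) ∂μ
      ≤ ∫⁻ y, ∑' k : ℤ, (Metric.closedBall x ((2 : ℝ) ^ (k + 1) * ε)).indicator
        (fun _ => ENNReal.ofReal (c k)) y ∂μ := lintegral_mono hpt
    _ = ∑' k : ℤ, ENNReal.ofReal (c k) * μ (Metric.closedBall x ((2 : ℝ) ^ (k + 1) * ε)) := by
      rw [lintegral_tsum fun k =>
        (measurable_const.indicator Metric.isClosed_closedBall.measurableSet).aemeasurable]
      simp_rw [lintegral_indicator_const Metric.isClosed_closedBall.measurableSet]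
    _ ≤ ∑' k : ℤ, ENNReal.ofReal (C * 2 ^ df * ε ^ (β - a) * b k) := ENNReal.tsum_le_tsum hterm
    _ = ENNReal.ofReal (C * 2 ^ df * ∑' k, b k * ε ^ (β - a)) := by
      rw [← ENNReal.ofReal_tsum_of_nonneg (fun k => by have := hb0 k; positivity)
        (hsum.mul_left _), tsum_mul_left, tsum_mul_right]
      congr 1
      ring
    _ = _ := by rw [tsum_mul_right]; congr 1; ring

/-- Balls of radius `ε / 2` about separated points are disjoint, each has mass at least of order `ε
^ df`, and the total mass is finite. -/
theorem IsAhlforsRegular.exists_card_le [BorelSpace X] (hμ : IsAhlforsRegular μ df) :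
    ∃ D : ℝ, 0 ≤ D ∧ ∀ ε : ℝ, 0 < ε → ε < Metric.diam (Set.univ : Set X) →
      ∀ S : Finset X, (S : Set X).Pairwise (fun x y => ε < dist x y) →
        (S.card : ℝ) ≤ D * ε ^ (-df) := by
  obtain ⟨C, hC, h⟩ := hμ
  have hC0 : 0 < C := by linarith
  refine ⟨C * 2 ^ df * μ.real Set.univ, by positivity, fun ε hε hd S hS => ?_⟩
  have hdisj : (S : Set X).PairwiseDisjoint fun x => Metric.closedBall x (ε / 2) := by
    intro x hx y hy hxy
    refine Metric.closedBall_disjoint_closedBall ?_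
    have := hS hx hy hxy
    linarith
  have hsum : ∑ x ∈ S, μ.real (Metric.closedBall x (ε / 2)) ≤ μ.real Set.univ := by
    rw [← measureReal_biUnion_finset hdisj fun x _ => Metric.isClosed_closedBall.measurableSet]
    exact measureReal_mono (Set.subset_univ _)
  have hlow : ∀ x ∈ S, C⁻¹ * (ε / 2) ^ df ≤ μ.real (Metric.closedBall x (ε / 2)) := fun x _ =>
    (ENNReal.ofReal_le_iff_le_toReal (measure_ne_top _ _)).1
      (h x (ε / 2) (by linarith) (by linarith)).1
  have := (Finset.card_nsmul_le_sum S _ _ hlow).trans hsum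
  rw [nsmul_eq_mul, Real.div_rpow hε.le zero_le_two] at this
  rw [Real.rpow_neg hε.le]
  have hε' : 0 < ε ^ df := by positivity
  have h2 : (0 : ℝ) < 2 ^ df := by positivity
  calc (S.card : ℝ) = C * 2 ^ df * (S.card * (C⁻¹ * (ε ^ df / 2 ^ df))) * (ε ^ df)⁻¹ := by
        field_simp
    _ ≤ _ := by gcongr

/-- The cells are nearest-point cells of the net; `SimpleFunc.nearestPtInd` breaks ties measurably.
-/
theorem exists_measurable_dist_le {X : Type*} [MetricSpace X] [MeasurableSpace X] [BorelSpace X]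
    (S : Finset X) (hS : S.Nonempty) {ε : ℝ} (hcov : ∀ y, ∃ z ∈ S, dist y z ≤ ε) :
    ∃ (e : Fin S.card → X) (π : X → Fin S.card), Measurable π ∧ ∀ y, dist y (e (π y)) ≤ ε := by
  have hpos : 0 < S.card := hS.card_pos
  let e : Fin S.card → X := fun i => S.equivFin.symm i
  -- `nearestPtInd` takes a sequence; the padding beyond `S.card - 1` is never selected.
  let e' : ℕ → X := fun i => if h : i < S.card then e ⟨i, h⟩ else e ⟨0, hpos⟩
  have hlt : ∀ y, SimpleFunc.nearestPtInd e' (S.card - 1) y < S.card := fun y => by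
    have := SimpleFunc.nearestPtInd_le e' (S.card - 1) y
    omega
  refine ⟨e, fun y => ⟨SimpleFunc.nearestPtInd e' (S.card - 1) y, hlt y⟩, ?_, fun y => ?_⟩
  · refine measurable_to_countable' fun i => ?_
    have : (fun y => (⟨SimpleFunc.nearestPtInd e' (S.card - 1) y, hlt y⟩ : Fin S.card)) ⁻¹' {i} =
        SimpleFunc.nearestPtInd e' (S.card - 1) ⁻¹' {(i : ℕ)} := by
      ext y
      simp [Fin.ext_iff]
    rw [this]
    exact SimpleFunc.measurableSet_fiber _ _
  · obtain ⟨z, hz, hyz⟩ := hcov y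
    have hk : (S.equivFin ⟨z, hz⟩ : ℕ) ≤ S.card - 1 := by
      have := (S.equivFin ⟨z, hz⟩).2
      omega
    have h := SimpleFunc.edist_nearestPt_le e' y hk
    have h1 : e' (S.equivFin ⟨z, hz⟩ : ℕ) = z := by simp [e', e]
    have h2 : SimpleFunc.nearestPt e' (S.card - 1) y =
        e ⟨SimpleFunc.nearestPtInd e' (S.card - 1) y, hlt y⟩ := by
      simp only [SimpleFunc.nearestPt, SimpleFunc.map_apply, e', dif_pos (hlt y)]
    rw [h1, h2, edist_dist, edist_dist, ENNReal.ofReal_le_ofReal_iff dist_nonneg] at h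
    rw [dist_comm]
    exact h.trans (by rwa [dist_comm])

/-- At scale `ε` the space is partitioned into `O(ε ^ (-df))` measurable cells. -/
theorem IsAhlforsRegular.exists_partition [BorelSpace X] (hμ : IsAhlforsRegular μ df) :
    ∃ D : ℝ, 0 ≤ D ∧ ∀ ε : ℝ, 0 < ε → ε < Metric.diam (Set.univ : Set X) →
      ∃ N : ℕ, (N : ℝ) ≤ D * ε ^ (-df) ∧
        ∃ (e : Fin N → X) (π : X → Fin N), Measurable π ∧ ∀ y, dist y (e (π y)) ≤ ε := by
  classical
  obtain ⟨D, hD, hcard⟩ := hμ.exists_card_le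
  refine ⟨D, hD, fun ε hε hd => ?_⟩
  have hcard := hcard ε hε hd
  -- The packing bound allows a separated set of largest size; any point it failed to cover could be
  -- added to it.
  let P : ℕ → Prop := fun n =>
    ∃ S : Finset X, S.card = n ∧ (S : Set X).Pairwise (fun x y => ε < dist x y)
  have hP0 : P 0 := ⟨∅, by simp⟩
  have hPB : ∀ n, P n → n ≤ ⌊D * ε ^ (-df)⌋₊ := by
    rintro n ⟨S, rfl, hS⟩
    exact Nat.le_floor (hcard S hS)
  obtain ⟨S, hSn, hS⟩ := Nat.findGreatest_spec (P := P) (Nat.zero_le ⌊D * ε ^ (-df)⌋₊) hP0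
  have hcov : ∀ y, ∃ z ∈ S, dist y z ≤ ε := by
    intro y
    by_contra! hy
    have hyS : y ∉ S := fun hyS => by
      have := hy y hyS
      rw [dist_self] at this
      linarith
    have hP : P (S.card + 1) := by
      refine ⟨insert y S, Finset.card_insert_of_notMem hyS, ?_⟩
      rw [Finset.coe_insert]
      refine hS.insert fun z hz _ => ⟨hy z hz, ?_⟩
      rw [dist_comm]
      exact hy z hz
    have := Nat.le_findGreatest (hPB _ hP) hP
    omega
  have hne : S.Nonempty := by
    rcases isEmpty_or_nonempty X with hX | ⟨⟨y⟩⟩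
    · have : (Set.univ : Set X) = ∅ := Set.univ_eq_empty_iff.2 hX
      rw [this, Metric.diam_empty] at hd
      linarith
    · obtain ⟨z, hz, _⟩ := hcov y
      exact ⟨z, hz⟩
  exact ⟨S.card, hcard S hS, exists_measurable_dist_le S hne hcov⟩

end Geometry

/-! ### Pointwise estimates for the kernel. -/

section Kernel

/-- For `a ≤ b`, factor out `(a ^ s)⁻¹` and use `1 - (a / b) ^ s ≤ s log (b / a) ≤ s (b / a - 1)`.
-/
theorem abs_inv_rpow_sub_inv_rpow_le {a b ρ δ s : ℝ} (hs : 0 ≤ s) (hρ : 0 < ρ) (ha : ρ ≤ a)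
    (hb : ρ ≤ b) (hab : |a - b| ≤ δ) :
    |(a ^ s)⁻¹ - (b ^ s)⁻¹| ≤ (ρ ^ s)⁻¹ * (s * (δ / ρ)) := by
  wlog hle : a ≤ b generalizing a b
  · rw [abs_sub_comm]
    exact this hb ha (by rwa [abs_sub_comm]) (le_of_not_ge hle)
  have ha0 : 0 < a := hρ.trans_le ha
  have hb0 : 0 < b := hρ.trans_le hb
  have hba : b - a ≤ δ := by
    rw [abs_sub_comm] at hab
    exact (le_abs_self _).trans hab
  have hδ : 0 ≤ δ := (sub_nonneg.2 hle).trans hba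
  have h1 : (b ^ s)⁻¹ ≤ (a ^ s)⁻¹ := by gcongr
  rw [abs_of_nonneg (sub_nonneg.2 h1)]
  have h2 : (a ^ s)⁻¹ - (b ^ s)⁻¹ = (a ^ s)⁻¹ * (1 - (a / b) ^ s) := by
    rw [Real.div_rpow ha0.le hb0.le]
    field_simp
  have h3 : 1 - (a / b) ^ s ≤ s * (δ / ρ) := by
    have h4 := Real.add_one_le_exp (Real.log (a / b) * s)
    rw [← Real.rpow_def_of_pos (div_pos ha0 hb0)] at h4
    have h5 := Real.log_le_sub_one_of_pos (div_pos hb0 ha0)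
    have h6 : Real.log (a / b) = -Real.log (b / a) := by rw [← Real.log_inv, inv_div]
    have h7 : b / a - 1 ≤ δ / ρ := by
      rw [div_sub_one ha0.ne']
      gcongr
    rw [h6] at h4
    nlinarith
  rw [h2]
  exact mul_le_mul (by gcongr) h3
    (sub_nonneg.2 (Real.rpow_le_one (by positivity) ((div_le_one hb0).2 hle) hs)) (by positivity)

variable {X 𝕜 : Type*} [MetricSpace X] [RCLike 𝕜]

theorem norm_commutatorKernel (df α : ℝ) (h : X → 𝕜) (x y : X) :
    ‖commutatorKernel df α h x y‖ = ‖h x - h y‖ / dist x y ^ (df + 2 * α) := by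
  rw [commutatorKernel, norm_div, RCLike.norm_ofReal, abs_of_nonneg (by positivity)]

/-- Away from the diagonal the distances from `x` to `y` and to `z` are comparable, so moving `y` to
`z` changes the numerator by `H ε ^ β` and the denominator by a relative amount `O(ε / dist x y)`.
-/
theorem norm_commutatorKernel_sub_le {df α β H : ℝ} (hs : 0 ≤ df + 2 * α) (hβ1 : β ≤ 1)
    {h : X → 𝕜} (hH : 0 ≤ H) (hh : ∀ x y, ‖h x - h y‖ ≤ H * dist x y ^ β) (hβ : 0 < β)
    {x y z : X} {ε : ℝ} (hε : 0 < ε) (hyz : dist y z ≤ ε) (hxz : 3 * ε < dist x z) :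
    ‖commutatorKernel df α h x y - commutatorKernel df α h x z‖ ≤
      (2 ^ (df + 2 * α) * (df + 2 * α) * 2 + 2 ^ (df + 2 * α)) * H *
        (ε ^ β / dist x y ^ (df + 2 * α)) := by
  have htri : |dist x y - dist x z| ≤ ε := by
    rw [dist_comm x y, dist_comm x z]
    exact (abs_dist_sub_le y z x).trans hyz
  set s := df + 2 * α
  set r := dist x y
  set r' := dist x z
  have hr2 : 2 * ε ≤ r := by
    have := (abs_le.1 htri).1
    linarith
  have hr0 : 0 < r := by linarith
  have hr' : r / 2 ≤ r' := by
    have := (abs_le.1 htri).2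
    linarith
  have hr'0 : 0 < r' := by linarith
  have hdec : commutatorKernel df α h x y - commutatorKernel df α h x z =
      (h x - h y) * ((((r ^ s)⁻¹ - (r' ^ s)⁻¹ : ℝ)) : 𝕜) +
        (h z - h y) * (((r' ^ s)⁻¹ : ℝ) : 𝕜) := by
    simp only [commutatorKernel]
    push_cast
    ring
  have hhalf : ((r / 2) ^ s)⁻¹ = 2 ^ s * (r ^ s)⁻¹ := by
    rw [Real.div_rpow hr0.le zero_le_two, inv_div, div_eq_mul_inv]
  have h1 : |(r ^ s)⁻¹ - (r' ^ s)⁻¹| ≤ 2 ^ s * (r ^ s)⁻¹ * (s * (ε / (r / 2))) := by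
    rw [← hhalf]
    exact abs_inv_rpow_sub_inv_rpow_le hs (by positivity) (by linarith) hr' htri
  have h2 : (r' ^ s)⁻¹ ≤ 2 ^ s * (r ^ s)⁻¹ := by
    rw [← hhalf]
    gcongr
  -- The relative gain `ε / r` is weakened to `(ε / r) ^ β`, so both errors have size `ε ^ β`; this
  -- needs `β ≤ 1`.
  have h3 : r ^ β * (ε / r) ≤ ε ^ β := by
    have h4 : ε / r ≤ (ε / r) ^ β := by
      have := Real.rpow_le_rpow_of_exponent_ge (div_pos hε hr0)
        ((div_le_one hr0).2 (by linarith)) hβ1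
      rwa [Real.rpow_one] at this
    calc r ^ β * (ε / r) ≤ r ^ β * (ε / r) ^ β := by gcongr
      _ = ε ^ β := by
        rw [← Real.mul_rpow hr0.le (by positivity), mul_div_cancel₀ _ hr0.ne']
  have h5 : ‖h z - h y‖ ≤ H * ε ^ β := by
    refine (hh z y).trans ?_
    rw [dist_comm]
    gcongr
  calc ‖commutatorKernel df α h x y - commutatorKernel df α h x z‖
      ≤ ‖h x - h y‖ * |(r ^ s)⁻¹ - (r' ^ s)⁻¹| + ‖h z - h y‖ * (r' ^ s)⁻¹ := by
        rw [hdec]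
        refine (norm_add_le _ _).trans_eq ?_
        rw [norm_mul, norm_mul, RCLike.norm_ofReal, RCLike.norm_ofReal,
          abs_of_nonneg (by positivity : (0 : ℝ) ≤ (r' ^ s)⁻¹)]
    _ ≤ (H * r ^ β) * (2 ^ s * (r ^ s)⁻¹ * (s * (ε / (r / 2)))) +
        (H * ε ^ β) * (2 ^ s * (r ^ s)⁻¹) := by
        have := hh x y
        gcongr
    _ = 2 ^ s * s * 2 * H * (r ^ s)⁻¹ * (r ^ β * (ε / r)) +
        2 ^ s * H * (ε ^ β * (r ^ s)⁻¹) := by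
        field_simp
    _ ≤ 2 ^ s * s * 2 * H * (r ^ s)⁻¹ * ε ^ β + 2 ^ s * H * (ε ^ β * (r ^ s)⁻¹) := by
        gcongr
    _ = _ := by
        rw [div_eq_mul_inv]
        ring

open Classical in
/-- The error made by freezing the second variable of the kernel at the point `z`, and dropping the
kernel near the diagonal. -/
theorem norm_commutatorKernel_sub_ite_le {df α β H : ℝ} (hs : 0 ≤ df + 2 * α) (hβ1 : β ≤ 1)
    {h : X → 𝕜} (hH : 0 ≤ H) (hh : ∀ x y, ‖h x - h y‖ ≤ H * dist x y ^ β) (hβ : 0 < β)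
    {x y z : X} {ε : ℝ} (hε : 0 < ε) (hyz : dist y z ≤ ε) :
    ‖commutatorKernel df α h x y - if 3 * ε < dist x z then commutatorKernel df α h x z else 0‖ ≤
      (2 ^ (df + 2 * α) * (df + 2 * α) * 2 + 2 ^ (df + 2 * α) + 4) * H *
        (min (dist x y) ε ^ β / dist x y ^ (df + 2 * α)) := by
  have htri : |dist x y - dist x z| ≤ ε := by
    rw [dist_comm x y, dist_comm x z]
    exact (abs_dist_sub_le y z x).trans hyz
  split_ifs with hxz
  · have hmin : min (dist x y) ε = ε := by
      refine min_eq_right ?_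
      have := (abs_le.1 htri).1
      linarith
    rw [hmin]
    refine (norm_commutatorKernel_sub_le hs hβ1 hH hh hβ hε hyz hxz).trans ?_
    refine mul_le_mul_of_nonneg_right (mul_le_mul_of_nonneg_right ?_ hH) (by positivity)
    linarith
  -- Near the diagonal nothing is subtracted, but `dist x y ≤ 4 ε`; the `4` in the constant comes
  -- from `4 ^ β ≤ 4`.
  · rw [sub_zero, norm_commutatorKernel]
    have hr : dist x y ≤ 4 * ε := by
      have := (abs_le.1 htri).2
      linarith
    have hr4 : dist x y ≤ 4 * min (dist x y) ε := by
      rcases min_choice (dist x y) ε with h | h <;> rw [h]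
      · linarith [dist_nonneg (x := x) (y := y)]
      · exact hr
    have hm : 0 ≤ min (dist x y) ε := by positivity
    have hpow : dist x y ^ β ≤ 4 * min (dist x y) ε ^ β := by
      calc dist x y ^ β ≤ (4 * min (dist x y) ε) ^ β := by gcongr
        _ = 4 ^ β * min (dist x y) ε ^ β := Real.mul_rpow (by norm_num) hm
        _ ≤ 4 * min (dist x y) ε ^ β := by
          gcongr
          have := Real.rpow_le_rpow_of_exponent_le (by norm_num : (1 : ℝ) ≤ 4) hβ1
          rwa [Real.rpow_one] at this
    calc ‖h x - h y‖ / dist x y ^ (df + 2 * α)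
        ≤ H * (4 * min (dist x y) ε ^ β) / dist x y ^ (df + 2 * α) := by
          gcongr
          exact (hh x y).trans (by gcongr)
      _ = 4 * H * (min (dist x y) ε ^ β / dist x y ^ (df + 2 * α)) := by ring
      _ ≤ _ := by
        gcongr
        have : 0 ≤ (2 : ℝ) ^ (df + 2 * α) * (df + 2 * α) * 2 + 2 ^ (df + 2 * α) := by positivity
        linarith

theorem HolderWith.norm_sub_le {H β : ℝ≥0} {h : X → 𝕜} (hh : HolderWith H β h) (x y : X) :
    ‖h x - h y‖ ≤ H * dist x y ^ (β : ℝ) := by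
  rw [← dist_eq_norm]
  exact hh.dist_le x y

theorem lintegral_majorant_le {X : Type*} [MetricSpace X] [MeasurableSpace X] {μ : Measure X}
    {A c ε β s γ : ℝ} (hc : 0 ≤ c)
    (hA : ∀ x : X, ∫⁻ y, ENNReal.ofReal (min (dist x y) ε ^ β / dist x y ^ s) ∂μ ≤
      ENNReal.ofReal (A * ε ^ γ)) (x : X) :
    ∫⁻ y, ENNReal.ofReal (c * (min (dist x y) ε ^ β / dist x y ^ s)) ∂μ ≤
      ENNReal.ofReal (c * (A * ε ^ γ)) := by
  simp_rw [ENNReal.ofReal_mul hc]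
  rw [lintegral_const_mul']
  · gcongr
    exact hA x
  · exact ENNReal.ofReal_ne_top

variable [CompactSpace X] [MeasurableSpace X] [BorelSpace X]

theorem measurable_commutatorKernel (df α : ℝ) {h : X → 𝕜} (hh : Continuous h) :
    Measurable (Function.uncurry (commutatorKernel df α h)) := by
  have h1 : Measurable fun z : X × X => h z.1 - h z.2 := by
    have : Continuous fun z : X × X => h z.1 - h z.2 := by fun_prop
    exact this.measurable
  have h2 : Measurable fun z : X × X => ((dist z.1 z.2 ^ (df + 2 * α) : ℝ) : 𝕜) :=
    RCLike.continuous_ofReal.measurable.comp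
      ((continuous_dist.measurable).pow_const _)
  exact h1.div h2

theorem measurable_majorant (c ε β s : ℝ) :
    Measurable (Function.uncurry fun x y : X =>
      ENNReal.ofReal (c * (min (dist x y) ε ^ β / dist x y ^ s))) := by
  have hd : Measurable fun z : X × X => dist z.1 z.2 := continuous_dist.measurable
  exact ((((hd.min measurable_const).pow_const β).div (hd.pow_const s)).const_mul c).ennreal_ofReal

end Kernel

/-! ### Decay of the singular values and Schatten bounds. -/

section Main

/-- For fixed `x` the frozen kernel is a function `w (π y)` of the cell alone, so zero cell means
annihilate it. -/
theorem integral_comp_mul_eq_zero {X 𝕜 : Type*} [MeasurableSpace X] [RCLike 𝕜] {μ : Measure X}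
    {N : ℕ} {π : X → Fin N} (hπ : Measurable π) {f : X → 𝕜} (hf : Integrable f μ)
    (h0 : ∀ i, ∫ y in π ⁻¹' {i}, f y ∂μ = 0) (w : Fin N → 𝕜) :
    Integrable (fun y => w (π y) * f y) μ ∧ ∫ y, w (π y) * f y ∂μ = 0 := by
  have hsum : (fun y => w (π y) * f y) =
      fun y => ∑ i, (π ⁻¹' {i}).indicator (fun y => w i * f y) y := by
    ext y
    rw [Finset.sum_eq_single (π y)]
    · simp
    · intro i _ hi
      exact Set.indicator_of_notMem (fun h => hi h.symm) _
    · simp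
  have hms : ∀ i, MeasurableSet (π ⁻¹' {i}) := fun i => hπ (measurableSet_singleton i)
  have hint : ∀ i, Integrable ((π ⁻¹' {i}).indicator fun y => w i * f y) μ := fun i =>
    (hf.const_mul _).indicator (hms i)
  rw [hsum]
  refine ⟨integrable_finsetSum _ fun i _ => hint i, ?_⟩
  rw [integral_finsetSum _ fun i _ => hint i]
  refine Finset.sum_eq_zero fun i _ => ?_
  rw [integral_indicator (hms i), integral_const_mul, h0 i, mul_zero]

variable {X 𝕜 : Type*} [MetricSpace X] [RCLike 𝕜] [CompactSpace X] [MeasurableSpace X]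
  [BorelSpace X] {μ : Measure X} [IsFiniteMeasure μ] {df α : ℝ} {β : ℝ≥0}

theorem exists_isIntegralOperator_commutatorKernel (hμ : IsAhlforsRegular μ df) (hdf : 0 < df)
    (hα : 0 < 2 * α) (hαβ : 2 * α < β) {h : X → 𝕜} (hh : MemHolder β h) :
    ∃ T : Lp 𝕜 2 μ →L[𝕜] Lp 𝕜 2 μ, IsIntegralOperator μ (commutatorKernel df α h) T := by
  obtain ⟨A, hA, hint⟩ := hμ.exists_lintegral_le hdf hα hαβ
  have hβ0 : 0 < (β : ℝ) := hα.trans hαβ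
  -- Beyond the diameter `min (dist x y) ε = dist x y`, and the majorant is the Hölder bound of the
  -- whole kernel.
  set ε := Metric.diam (Set.univ : Set X) + 1
  have hε : 0 < ε := by positivity
  set H := nnHolderNorm β h
  have hmaj := lintegral_majorant_le H.2 (hint ε hε)
  refine exists_isIntegralOperator (measurable_majorant H ε β (df + 2 * α))
    (A := H * (A * ε ^ (β - 2 * α))) (by positivity) hmaj ?_
    (measurable_commutatorKernel df α (hh.holderWith.continuous (by exact_mod_cast hβ0))) ?_
  · intro y
    simp_rw [dist_comm _ y]
    exact hmaj y
  · intro x y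
    rw [← ofReal_norm, norm_commutatorKernel]
    refine ENNReal.ofReal_le_ofReal ?_
    have hd : dist x y ≤ ε := by
      have := Metric.dist_le_diam_of_mem (isCompact_univ (X := X)).isBounded
        (Set.mem_univ x) (Set.mem_univ y)
      linarith
    rw [min_eq_left hd, ← mul_div_assoc]
    gcongr
    exact hh.holderWith.norm_sub_le x y

/-- Outside a space of dimension `O(ε ^ (-df))` the operator has norm `O(ε ^ (β - 2α))`. -/
theorem exists_orthogonal_norm_le (𝕜 : Type*) [RCLike 𝕜] (hμ : IsAhlforsRegular μ df)
    (hdf : 0 < df) (hα : 0 < 2 * α) (hαβ : 2 * α < β) (hβ : β ≤ 1) :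
    ∃ B D : ℝ, 0 ≤ B ∧ 0 ≤ D ∧ ∀ h : X → 𝕜, MemHolder β h → ∀ T : Lp 𝕜 2 μ →L[𝕜] Lp 𝕜 2 μ,
      IsIntegralOperator μ (commutatorKernel df α h) T → ∀ ε : ℝ, 0 < ε →
        ∃ N : ℕ, (N : ℝ) ≤ D * ε ^ (-df) ∧ ∃ g : Fin N → Lp 𝕜 2 μ,
          ∀ f, (∀ i, inner 𝕜 (g i) f = 0) →
            ‖T f‖ ≤ B * nnHolderNorm β h * ε ^ (β - 2 * α) * ‖f‖ := by
  classical
  obtain ⟨A, hA, hint⟩ := hμ.exists_lintegral_le hdf hα hαβ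
  obtain ⟨D, hD, hpart⟩ := hμ.exists_partition
  have hs : 0 ≤ df + 2 * α := by linarith
  have hβ0 : 0 < (β : ℝ) := hα.trans hαβ
  have hβ1 : (β : ℝ) ≤ 1 := by exact_mod_cast hβ
  set c : ℝ := 2 ^ (df + 2 * α) * (df + 2 * α) * 2 + 2 ^ (df + 2 * α) + 4 with hc
  have hc4 : 4 ≤ c := by
    have : 0 ≤ (2 : ℝ) ^ (df + 2 * α) * (df + 2 * α) * 2 + 2 ^ (df + 2 * α) := by positivity
    linarith
  refine ⟨c * A, D, by positivity, hD, fun h hh T hT ε hε => ?_⟩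
  set H := nnHolderNorm β h
  have hH := hh.holderWith.norm_sub_le
  have hcH : 0 ≤ c * H := by positivity
  have hmaj := lintegral_majorant_le hcH (hint ε hε)
  have hmaj' : ∀ y, ∫⁻ x, ENNReal.ofReal (c * H * (min (dist x y) ε ^ (β : ℝ) /
      dist x y ^ (df + 2 * α))) ∂μ ≤ ENNReal.ofReal (c * H * (A * ε ^ (β - 2 * α))) := by
    intro y
    simp_rw [dist_comm _ y]
    exact hmaj y
  have key : ∀ f : Lp 𝕜 2 μ, (∀ᵐ x ∂μ, ‖T f x‖ₑ ≤ ∫⁻ y, ENNReal.ofReal (c * H *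
      (min (dist x y) ε ^ (β : ℝ) / dist x y ^ (df + 2 * α))) * ‖f y‖ₑ ∂μ) →
      ‖T f‖ ≤ c * A * H * ε ^ (β - 2 * α) * ‖f‖ := by
    intro f hf
    refine (norm_le_of_enorm_le_lintegral (measurable_majorant _ ε β (df + 2 * α))
      (by positivity) hmaj hmaj' hf).trans_eq ?_
    ring
  rcases lt_or_ge ε (Metric.diam (Set.univ : Set X)) with hd | hd
  · obtain ⟨N, hN, e, π, hπ, hdist⟩ := hpart ε hε hd
    -- Orthogonality to the cell indicators is vanishing of the cell means.
    refine ⟨N, hN, fun i => indicatorConstLp 2 (hπ (measurableSet_singleton i))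
      (measure_ne_top _ _) (1 : 𝕜), fun f hf => key f ?_⟩
    filter_upwards [hT f] with x hx
    obtain ⟨hi, hx⟩ := hx
    have h0 : ∀ i, ∫ y in π ⁻¹' {i}, f y ∂μ = 0 := fun i => by
      rw [← L2.inner_indicatorConstLp_one (hπ (measurableSet_singleton i)) (measure_ne_top _ _) f]
      exact hf i
    obtain ⟨hw1, hw2⟩ := integral_comp_mul_eq_zero hπ ((Lp.memLp f).integrable one_le_two) h0
      (fun i => if 3 * ε < dist x (e i) then commutatorKernel df α h x (e i) else 0)
    rw [hx, ← sub_zero (∫ y, _ ∂μ), ← hw2, ← integral_sub hi hw1]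
    refine (enorm_integral_le_lintegral_enorm _).trans (lintegral_mono fun y => ?_)
    rw [← sub_mul, enorm_mul]
    refine mul_le_mul_left ?_ _
    rw [← ofReal_norm]
    exact ENNReal.ofReal_le_ofReal
      (norm_commutatorKernel_sub_ite_le hs hβ1 H.2 hH hβ0 hε (hdist y))
  -- At scales above the diameter the plain Hölder bound suffices, without any orthogonality
  -- condition.
  · refine ⟨0, by simpa using by positivity, Fin.elim0, fun f _ => key f ?_⟩
    filter_upwards [hT f] with x hx
    rw [hx.2]
    refine (enorm_integral_le_lintegral_enorm _).trans (lintegral_mono fun y => ?_)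
    rw [enorm_mul]
    refine mul_le_mul_left ?_ _
    rw [← ofReal_norm, norm_commutatorKernel]
    refine ENNReal.ofReal_le_ofReal ?_
    have hxy : dist x y ≤ ε := (Metric.dist_le_diam_of_mem (isCompact_univ (X := X)).isBounded
      (Set.mem_univ x) (Set.mem_univ y)).trans hd
    rw [min_eq_left hxy, ← mul_div_assoc]
    gcongr
    calc ‖h x - h y‖ ≤ 1 * H * dist x y ^ (β : ℝ) := by rw [one_mul]; exact hH x y
      _ ≤ c * H * dist x y ^ (β : ℝ) := by gcongr; linarith

theorem singularValue_le_of_scale {H : Type*} [NormedAddCommGroup H] [InnerProductSpace 𝕜 H]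
    [CompleteSpace H] {T : H →L[𝕜] H} {M D γ : ℝ} (hM : 0 ≤ M) (hD : 0 ≤ D) (hdf : 0 < df)
    (hT : ∀ ε : ℝ, 0 < ε → ∃ N : ℕ, (N : ℝ) ≤ D * ε ^ (-df) ∧ ∃ g : Fin N → H,
      ∀ f, (∀ i, inner 𝕜 (g i) f = 0) → ‖T f‖ ≤ M * ε ^ γ * ‖f‖) (n : ℕ) :
    singularValue T n ≤ M * (2 * (D + 1) / (n + 1)) ^ (γ / df) := by
  have hq : 0 < 2 * (D + 1) / ((n : ℝ) + 1) := by positivity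
  -- This `ε` makes `D * ε ^ (-df) ≤ (n + 1) / 2`, whence `N ≤ n`, including `N = 0` at `n = 0`. `D
  -- + 1` keeps `ε` positive when `D = 0`.
  obtain ⟨N, hN, g, hg⟩ := hT ((2 * (D + 1) / (n + 1)) ^ (1 / df)) (by positivity)
  rw [← Real.rpow_mul hq.le, one_div_mul_eq_div] at hg
  refine singularValue_le_of_orthogonal T (by positivity) ?_ g hg
  have h1 : (N : ℝ) ≤ (n + 1) / 2 := by
    rw [← Real.rpow_mul hq.le, one_div_mul_eq_div, neg_div, div_self hdf.ne',
      Real.rpow_neg_one, inv_div] at hN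
    refine hN.trans ?_
    rw [mul_div_assoc', div_le_div_iff₀ (by positivity) two_pos]
    nlinarith [(Nat.cast_nonneg n : (0 : ℝ) ≤ n)]
  have h2 : 2 * N ≤ n + 1 := by
    have : (2 * N : ℝ) ≤ n + 1 := by linarith
    exact_mod_cast this
  omega

theorem isCompactOperator_of_scale {H : Type*} [NormedAddCommGroup H] [InnerProductSpace 𝕜 H]
    [CompleteSpace H] {T : H →L[𝕜] H} {M γ : ℝ} (hM : 0 ≤ M) (hγ : 0 < γ)
    (hT : ∀ ε : ℝ, 0 < ε → ∃ (N : ℕ) (g : Fin N → H),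
      ∀ f, (∀ i, inner 𝕜 (g i) f = 0) → ‖T f‖ ≤ M * ε ^ γ * ‖f‖) :
    IsCompactOperator T := by
  refine isCompactOperator_of_orthogonal T fun η hη => ?_
  have hq : 0 < η / (M + 1) := by positivity
  obtain ⟨N, g, hg⟩ := hT ((η / (M + 1)) ^ (1 / γ)) (by positivity)
  refine ⟨N, g, fun f hf => (hg f hf).trans ?_⟩
  rw [← Real.rpow_mul hq.le, one_div_mul_cancel hγ.ne', Real.rpow_one]
  gcongr
  rw [mul_div_assoc', div_le_iff₀ (by positivity)]
  nlinarith

theorem summable_div_rpow_rpow {D q p : ℝ} (hD : 0 ≤ D) (hqp : 1 < q * p) :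
    Summable fun n : ℕ => ((D / ((n : ℝ) + 1)) ^ q) ^ p := by
  have h := ((summable_nat_add_iff 1).2 (Real.summable_nat_rpow_inv.2 hqp)).mul_left (D ^ (q * p))
  refine h.congr fun n => ?_
  rw [← Real.rpow_mul (by positivity), Real.div_rpow hD (by positivity), div_eq_mul_inv]
  push_cast
  rfl

/-- Termwise comparison needs no triangle inequality, so `p < 1` is covered. -/
theorem memSchatten_of_singularValue_le {H : Type*} [NormedAddCommGroup H]
    [InnerProductSpace 𝕜 H] [CompleteSpace H] {T : H →L[𝕜] H} (hT : IsCompactOperator T)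
    {M p : ℝ} (hM : 0 ≤ M) (hp : 0 < p) {w : ℕ → ℝ} (hw0 : ∀ n, 0 ≤ w n)
    (hw : Summable fun n => w n ^ p) (hle : ∀ n, singularValue T n ≤ M * w n) :
    MemSchatten p T ∧ schattenNorm p T ≤ M * (∑' n, w n ^ p) ^ (1 / p) := by
  have hpow : ∀ n, singularValue T n ^ p ≤ M ^ p * w n ^ p := fun n => by
    rw [← Real.mul_rpow hM (hw0 n)]
    exact Real.rpow_le_rpow (singularValue_nonneg T n) (hle n) hp.le
  have hpos : ∀ n, 0 ≤ singularValue T n ^ p := fun n =>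
    Real.rpow_nonneg (singularValue_nonneg T n) p
  have hsum := Summable.of_nonneg_of_le hpos hpow (hw.mul_left _)
  have hw0' : 0 ≤ ∑' n, w n ^ p := tsum_nonneg fun n => Real.rpow_nonneg (hw0 n) p
  refine ⟨⟨hT, hsum⟩, ?_⟩
  calc schattenNorm p T ≤ (M ^ p * ∑' n, w n ^ p) ^ (1 / p) := by
        rw [← tsum_mul_left]
        exact Real.rpow_le_rpow (tsum_nonneg hpos) (hsum.tsum_le_tsum hpow (hw.mul_left _))
          (by positivity)
    _ = _ := by
        rw [Real.mul_rpow (by positivity) hw0', ← Real.rpow_mul hM, mul_one_div_cancel hp.ne',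
          Real.rpow_one]

theorem exists_schattenNorm_le (𝕜 : Type*) [RCLike 𝕜] (hμ : IsAhlforsRegular μ df)
    (hdf : 0 < df) (hα : 0 < 2 * α) (hαβ : 2 * α < β) (hβ : β ≤ 1) {p : ℝ}
    (hp : df / (β - 2 * α) < p) :
    ∃ L : ℝ, 0 < L ∧ ∀ h : X → 𝕜, MemHolder β h →
      ∀ T : Lp 𝕜 2 μ →L[𝕜] Lp 𝕜 2 μ, IsIntegralOperator μ (commutatorKernel df α h) T →
        MemSchatten p T ∧ schattenNorm p T ≤ L * nnHolderNorm β h := by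
  obtain ⟨B, D, hB, hD, hscale⟩ := exists_orthogonal_norm_le 𝕜 hμ hdf hα hαβ hβ
  have hγ : 0 < (β : ℝ) - 2 * α := sub_pos.2 hαβ
  have hp0 : 0 < p := (div_pos hdf hγ).trans hp
  have hqp : 1 < (β - 2 * α) / df * p := by
    rw [div_lt_iff₀ hγ] at hp
    rw [div_mul_eq_mul_div, one_lt_div hdf]
    linarith
  have hw := summable_div_rpow_rpow (D := 2 * (D + 1)) (by positivity) hqp
  set w : ℕ → ℝ := fun n => (2 * (D + 1) / ((n : ℝ) + 1)) ^ ((β - 2 * α) / df)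
  have hw0 : ∀ n, 0 ≤ w n := fun n => by positivity
  have hZ : 0 ≤ (∑' n, w n ^ p) ^ (1 / p) :=
    Real.rpow_nonneg (tsum_nonneg fun n => Real.rpow_nonneg (hw0 n) p) _
  -- `B` and `w` do not depend on `h`; the `+ 1` ensures positivity.
  refine ⟨B * (∑' n, w n ^ p) ^ (1 / p) + 1, by positivity, fun h hh T hT => ?_⟩
  have hM : 0 ≤ B * nnHolderNorm β h := by positivity
  have hcompact : IsCompactOperator T := isCompactOperator_of_scale hM hγ fun ε hε => by
    obtain ⟨N, -, g, hg⟩ := hscale h hh T hT ε hε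
    exact ⟨N, g, hg⟩
  obtain ⟨h1, h2⟩ := memSchatten_of_singularValue_le hcompact hM hp0 hw0 hw
    (singularValue_le_of_scale hM hD hdf (hscale h hh T hT))
  refine ⟨h1, h2.trans ?_⟩
  nlinarith [(nnHolderNorm β h).2]

end Main

theorem mainTheorem7 {𝕜 : Type*} [RCLike 𝕜]
    {X : Type*} [MetricSpace X] [CompactSpace X] [MeasurableSpace X] [BorelSpace X]
    (μ : Measure X) [IsFiniteMeasure μ] (df : ℝ) (hdf : 0 < df) (hμ : IsAhlforsRegular μ df)
    (α : ℝ) (β : ℝ≥0) (hα : 0 < 2 * α) (hαβ : 2 * α < β) (hβ : β ≤ 1) :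
    (∀ h : X → 𝕜, MemHolder β h →
      ∃! T : Lp 𝕜 2 μ →L[𝕜] Lp 𝕜 2 μ, IsIntegralOperator μ (commutatorKernel df α h) T) ∧
    ∀ l : ℕ, (l = ⌈df / β⌉₊ + 1 ∨ (l = 1 ∧ 2 ≤ df / (β - 2 * α))) →
      ∀ p : ℝ, l * df / (β - 2 * α) < p →
        ∃ L : ℝ, 0 < L ∧ ∀ h : X → 𝕜, MemHolder β h →
          ∀ T : Lp 𝕜 2 μ →L[𝕜] Lp 𝕜 2 μ, IsIntegralOperator μ (commutatorKernel df α h) T →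
            MemSchatten p T ∧ schattenNorm p T ≤ L * nnHolderNorm β h := by
  refine ⟨fun h hh => ?_, fun l hl p hp => exists_schattenNorm_le 𝕜 hμ hdf hα hαβ hβ ?_⟩
  · obtain ⟨T, hT⟩ := exists_isIntegralOperator_commutatorKernel hμ hdf hα hαβ hh
    exact ⟨T, hT, fun S hS => hS.unique hT⟩
  -- Either choice of `l` is at least `1`, so `p` already exceeds `df / (β - 2 * α)`.
  · have hl1 : 1 ≤ l := by omega
    have hγ : 0 < (β : ℝ) - 2 * α := sub_pos.2 hαβ
    refine lt_of_le_of_lt ?_ hp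
    gcongr
    exact le_mul_of_one_le_left hdf.le (by exact_mod_cast hl1)
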